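/- For a positive integer $n=p_1^{\alpha_1}\cdots p_k^{\alpha_k}$ ($p_i$ distinct primes, $\alpha_i\ge 1$) let $\omega(n)=k$ be the number of distinct prime factors of $n$ and $\Omega(n)=\alpha_1+\dots+\alpha_k$ the number of prime factors counted with multiplicity (so $\omega(1)=\Omega(1)=0$). Let $g=\omega$ or $g=\Omega$, and put $S_{g,K}=\sum_{1\le n\le K} g(n)$, which is positive for $K\ge 2$. Let $(X,\mathcal A,\mu)$ be a probability space and let $T:X\to X$ be an ergodic measure-preserving transformation (not necessarily invertible). Then for every real- or complex-valued $f\in L^1(X,\mu)$, $$\lim_{K\to\infty}\frac{1}{S_{g,K}}\sum_{n=1}^{K} g(n)\,f(T^{n}x)=\int_X f\,d\mu\qquad\text{for }\mu\text{-a.e. }x\in X.$$ -/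

import Mathlib

/-- The partial sum `S_{g,K} = ∑_{n ≤ K} g(n)` over the positive integers `n ≤ K`. -/
def weightSum (g : ℕ → ℕ) (K : ℕ) : ℕ :=
  ∑ n ∈ Finset.Icc 1 K, g n

/-- The `g`-weighted ergodic average `(1 / S_{g,K}) ∑_{n=1}^{K} g(n) f(Tⁿ x)`.
It takes the junk value `0` when `S_{g,K} = 0`; for the prime divisor functions this
happens only for `K ≤ 1`. -/
noncomputable def weightedErgodicAverage {X 𝕜 : Type*} [RCLike 𝕜]
    (g : ℕ → ℕ) (T : X → X) (f : X → 𝕜) (K : ℕ) (x : X) : 𝕜 :=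
  (1 / (weightSum g K : 𝕜)) * ∑ n ∈ Finset.Icc 1 K, (g n : 𝕜) * f (T^[n] x)

/-!
The weights `ω(n)` and `Ω(n)` concentrate around the slowly growing mean
`L K = ∑_{p ≤ K} 1 / p ≥ log log K - O(1)`: by Turán's second moment estimate, and since `Ω - ω` is
bounded in mean, `∑_{n ≤ K} |g n - L K| = o(K * L K)`
(`tendsto_sum_abs_sub_primeReciprocalSum_div`). For bounded `f` the weighted averages may therefore
be compared with the unweighted ones, which converge by Birkhoff's theorem
(`ae_tendsto_average_iterate`).

For integrable `f` the set where `|f|` exceeds a height `M` has to be controlled as well, and there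
the question is how often the weights are much larger than `L K`. The bound
`∑_{n ≤ N} √2 ^ Ω(n) / n ≤ (∑_{n ≤ N} 1 / n) ^ 3` and the inequality `x ≤ exp x` give
`Ω(n) ≤ C (log log₂ n + b n)` with `b n = √2 ^ Ω(n) / (log₂ n) ^ 5` (`excessWeight`), and
`∑ b n / n` converges (`summable_excessWeight_div`). The part `C log log₂ n ≤ 2 C L K` of the weight
(for large `K`) costs a constant times the unweighted average of `|f| 1_{|f| > M}`, whose limit
`∫ |f| 1_{|f| > M}` is small for large `M`. The part `C b n` is negligible along almost every orbit:
since `∑ b n / n · ∫ |f ∘ T^n|` converges, so does `∑ b n |f (T^n x)| / n` for almost every `x`, and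
thus `∑_{n ≤ K} b n |f (T^n x)| = O(K) = o(K * L K)`. No maximal inequality for the weighted averages
is needed. The comparison for a single orbit is `tendsto_weighted_average`.

Birkhoff's theorem is deduced from the running maxima of the Birkhoff sums
(`ae_birkhoffSum_bddAbove`): for a function with negative integral these stay bounded almost
everywhere.
-/

open MeasureTheory Filter Topology
open ArithmeticFunction (cardFactors cardDistinctFactors)

/-! ### Birkhoff's pointwise ergodic theorem -/

/-- The running maximum `max_{0 ≤ k ≤ n} ∑_{j < k} φ (T^j x)` of the Birkhoff sums of `φ`
(the empty sum included), defined by the recursion that it satisfies along the orbit. -/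
noncomputable def birkhoffMax {X : Type*} (T : X → X) (φ : X → ℝ) : ℕ → X → ℝ
  | 0, _ => 0
  | n + 1, x => max 0 (φ x + birkhoffMax T φ n (T x))

section Birkhoff

variable {X : Type*} {T : X → X} {φ : X → ℝ}

lemma birkhoffMax_nonneg (n : ℕ) (x : X) : 0 ≤ birkhoffMax T φ n x := by
  cases n with
  | zero => exact le_rfl
  | succ n => exact le_max_left _ _

lemma birkhoffMax_le_succ (n : ℕ) (x : X) :
    birkhoffMax T φ n x ≤ birkhoffMax T φ (n + 1) x := by
  induction n generalizing x with
  | zero => exact birkhoffMax_nonneg _ _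
  | succ n ih => exact max_le_max le_rfl (add_le_add le_rfl (ih (T x)))

lemma birkhoffMax_monotone (x : X) : Monotone fun n => birkhoffMax T φ n x :=
  monotone_nat_of_le_succ fun n => birkhoffMax_le_succ n x

lemma birkhoffSum_le_birkhoffMax (n : ℕ) (x : X) :
    birkhoffSum T φ n x ≤ birkhoffMax T φ n x := by
  induction n generalizing x with
  | zero => simp [birkhoffMax]
  | succ n ih =>
    rw [birkhoffSum_succ']
    exact le_max_of_le_right (add_le_add le_rfl (ih (T x)))

/-- The points with unbounded partial maxima form a strictly invariant set. -/
lemma preimage_unbounded_birkhoffMax :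
    T ⁻¹' {x | ∀ C : ℕ, ∃ n, (C : ℝ) < birkhoffMax T φ n x} =
      {x | ∀ C : ℕ, ∃ n, (C : ℝ) < birkhoffMax T φ n x} := by
  ext x
  constructor
  · intro h C
    obtain ⟨N, hN⟩ := exists_nat_gt ((C : ℝ) - φ x)
    obtain ⟨n, hn⟩ := h N
    exact ⟨n + 1, lt_max_of_lt_right (by linarith)⟩
  · intro h C
    obtain ⟨N, hN⟩ := exists_nat_gt ((C : ℝ) + |φ x|)
    obtain ⟨n, hn⟩ := h N
    refine ⟨n, ?_⟩
    have h1 := hn.trans_le (birkhoffMax_le_succ n x)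
    have h2 : (C : ℝ) + |φ x| < max 0 (φ x + birkhoffMax T φ n (T x)) := hN.trans h1
    have hC : (0 : ℝ) ≤ C := Nat.cast_nonneg C
    rcases lt_max_iff.1 h2 with h3 | h3
    · exact absurd h3 (by have := abs_nonneg (φ x); linarith)
    · have := le_abs_self (φ x); linarith

variable [MeasurableSpace X] {μ : Measure X}

lemma measurable_birkhoffMax (hT : Measurable T) (hφ : Measurable φ) (n : ℕ) :
    Measurable (birkhoffMax T φ n) := by
  induction n with
  | zero => exact measurable_const
  | succ n ih => exact measurable_const.max (hφ.add (ih.comp hT))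

lemma integrable_birkhoffMax [IsFiniteMeasure μ] (hT : MeasurePreserving T μ μ)
    (hφ : Integrable φ μ) (n : ℕ) : Integrable (birkhoffMax T φ n) μ := by
  induction n with
  | zero => exact integrable_zero _ _ _
  | succ n ih =>
    exact (integrable_zero X ℝ μ).sup (hφ.add (hT.integrable_comp_of_integrable ih))

/-- If the Birkhoff sums were unbounded above almost everywhere, the increments
`birkhoffMax (n + 1) - birkhoffMax n ∘ T = max (-birkhoffMax n ∘ T) φ` would converge dominatedly
to `φ`, while their integrals are nonnegative by invariance of the measure. -/
lemma ae_birkhoffSum_bddAbove [IsProbabilityMeasure μ] (hT : Ergodic T μ) (hφm : Measurable φ)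
    (hφ : Integrable φ μ) (hneg : ∫ x, φ x ∂μ < 0) :
    ∀ᵐ x ∂μ, ∃ C : ℝ, ∀ n, birkhoffSum T φ n x ≤ C := by
  have hmeas : MeasurableSet {x | ∀ C : ℕ, ∃ n, (C : ℝ) < birkhoffMax T φ n x} := by
    have : {x | ∀ C : ℕ, ∃ n, (C : ℝ) < birkhoffMax T φ n x} =
        ⋂ C : ℕ, ⋃ n, {x | (C : ℝ) < birkhoffMax T φ n x} := by ext; simp
    rw [this]
    exact .iInter fun C => .iUnion fun n =>
      measurableSet_lt measurable_const (measurable_birkhoffMax hT.measurable hφm n)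
  rcases hT.toPreErgodic.ae_mem_or_ae_notMem hmeas preimage_unbounded_birkhoffMax with h | h
  · exfalso
    have hint := integrable_birkhoffMax (μ := μ) hT.toMeasurePreserving hφ
    have hD : ∀ n x, birkhoffMax T φ (n + 1) x - birkhoffMax T φ n (T x) =
        max (-birkhoffMax T φ n (T x)) (φ x) := by
      intro n x
      change max 0 _ - _ = _
      rw [← max_sub_sub_right]
      ring_nf
    have hlim : Tendsto (fun n => ∫ x, (birkhoffMax T φ (n + 1) x - birkhoffMax T φ n (T x)) ∂μ)
        atTop (𝓝 (∫ x, φ x ∂μ)) := by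
      refine tendsto_integral_of_dominated_convergence (fun x => |φ x|) (fun n => ?_) hφ.abs
        (fun n => ?_) ?_
      · exact ((hint (n + 1)).sub
          (hT.toMeasurePreserving.integrable_comp_of_integrable (hint n))).aestronglyMeasurable
      · refine Eventually.of_forall fun x => ?_
        rw [hD, Real.norm_eq_abs]
        have h0 := birkhoffMax_nonneg (T := T) (φ := φ) n (T x)
        rcases max_cases (-birkhoffMax T φ n (T x)) (φ x) with ⟨h1, h2⟩ | ⟨h1, h2⟩
        · rw [h1, abs_of_nonpos (by linarith), abs_of_nonpos (by linarith)]
          linarith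
        · rw [h1]
      · filter_upwards [h] with x hx
        have hx' : x ∈ T ⁻¹' {x | ∀ C : ℕ, ∃ n, (C : ℝ) < birkhoffMax T φ n x} := by
          rw [preimage_unbounded_birkhoffMax]; exact hx
        obtain ⟨N, hN⟩ := exists_nat_gt (-φ x)
        obtain ⟨n₀, hn₀⟩ := hx' N
        refine tendsto_const_nhds.congr' ?_
        filter_upwards [eventually_ge_atTop n₀] with n hn
        have := birkhoffMax_monotone (T := T) (φ := φ) (T x) hn
        rw [hD, max_eq_right]
        simp only at this
        linarith
    refine absurd (ge_of_tendsto' hlim fun n => ?_) (not_le.2 hneg)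
    have hintT : Integrable (fun x => birkhoffMax T φ n (T x)) μ :=
      hT.toMeasurePreserving.integrable_comp_of_integrable (hint n)
    rw [integral_sub (hint (n + 1)) hintT]
    have hcomp : ∫ x, birkhoffMax T φ n (T x) ∂μ = ∫ x, birkhoffMax T φ n x ∂μ := by
      have := integral_map (μ := μ) hT.measurable.aemeasurable (f := birkhoffMax T φ n)
        (by rw [hT.map_eq]; exact (hint n).aestronglyMeasurable)
      rw [hT.map_eq] at this
      exact this.symm
    rw [hcomp, sub_nonneg]
    exact integral_mono (hint n) (hint (n + 1)) (birkhoffMax_le_succ n)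
  · filter_upwards [h] with x hx
    simp only [not_forall, not_exists, not_lt] at hx
    obtain ⟨C, hC⟩ := hx
    exact ⟨C, fun n => (birkhoffSum_le_birkhoffMax n x).trans (hC n)⟩

lemma ae_eventually_birkhoffAverage_le [IsProbabilityMeasure μ] (hT : Ergodic T μ)
    (hφm : Measurable φ) (hφ : Integrable φ μ) {ε : ℝ} (hε : 0 < ε) :
    ∀ᵐ x ∂μ, ∀ᶠ n : ℕ in atTop, birkhoffAverage ℝ T φ n x ≤ ∫ y, φ y ∂μ + ε := by
  set c := ∫ y, φ y ∂μ + ε / 2 with hc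
  -- `φ - c` has negative integral, so `∑ φ ≤ n c + O(1)`; the other `ε / 2` absorbs `O(1) / n`.
  have hneg : ∫ x, (φ x - c) ∂μ < 0 := by
    rw [integral_sub hφ (integrable_const _)]
    simp [hc, hε]
  filter_upwards [ae_birkhoffSum_bddAbove hT (hφm.sub measurable_const)
    (hφ.sub (integrable_const c)) hneg] with x ⟨C, hC⟩
  have hlim : Tendsto (fun n : ℕ => C / (n : ℝ)) atTop (𝓝 0) :=
    tendsto_const_div_atTop_nhds_zero_nat C
  filter_upwards [hlim.eventually_lt_const (half_pos hε), eventually_gt_atTop 0] with n hn hn0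
  have hn0' : (0 : ℝ) < n := Nat.cast_pos.2 hn0
  have h1 : birkhoffSum T φ n x - n * c ≤ C := by
    have := hC n
    simpa [birkhoffSum, Finset.sum_sub_distrib] using this
  rw [birkhoffAverage, smul_eq_mul, inv_mul_le_iff₀ hn0']
  rw [div_lt_iff₀ hn0'] at hn
  rw [hc] at h1
  nlinarith

/-- Birkhoff's pointwise ergodic theorem for an ergodic transformation, real-valued case. -/
theorem ae_tendsto_birkhoffAverage_real [IsProbabilityMeasure μ] (hT : Ergodic T μ)
    (hφ : Integrable φ μ) :
    ∀ᵐ x ∂μ, Tendsto (fun n => birkhoffAverage ℝ T φ n x) atTop (𝓝 (∫ y, φ y ∂μ)) := by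
  wlog hφm : Measurable φ generalizing φ
  · have hae := hφ.1.ae_eq_mk
    have h := this (hφ.congr hae) hφ.1.stronglyMeasurable_mk.measurable
    have heq : ∀ᵐ x ∂μ, ∀ n, birkhoffAverage ℝ T φ n x =
        birkhoffAverage ℝ T (hφ.1.mk φ) n x :=
      ae_all_iff.2 fun n => hT.quasiMeasurePreserving.birkhoffAverage_ae_eq_of_ae_eq ℝ hae n
    filter_upwards [h, heq] with x hx hx'
    simpa only [hx', integral_congr_ae hae] using hx
  have hup : ∀ᵐ x ∂μ, ∀ m : ℕ, ∀ᶠ n : ℕ in atTop,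
      birkhoffAverage ℝ T φ n x ≤ ∫ y, φ y ∂μ + 1 / ((m : ℝ) + 1) :=
    ae_all_iff.2 fun m => ae_eventually_birkhoffAverage_le hT hφm hφ (by positivity)
  have hlo : ∀ᵐ x ∂μ, ∀ m : ℕ, ∀ᶠ n : ℕ in atTop,
      birkhoffAverage ℝ T (-φ) n x ≤ ∫ y, (-φ) y ∂μ + 1 / ((m : ℝ) + 1) :=
    ae_all_iff.2 fun m => ae_eventually_birkhoffAverage_le hT hφm.neg hφ.neg (by positivity)
  filter_upwards [hup, hlo] with x hx1 hx2
  rw [Metric.tendsto_nhds]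
  intro ε hε
  obtain ⟨m, hm⟩ := exists_nat_one_div_lt hε
  filter_upwards [hx1 m, hx2 m] with n h1 h2
  rw [birkhoffAverage_neg, Pi.neg_apply, Pi.neg_apply] at h2
  simp only [Pi.neg_apply, integral_neg] at h2
  rw [Real.dist_eq, abs_lt]
  constructor <;> linarith

/-- Birkhoff's pointwise ergodic theorem for the averages over the orbit `T x, T² x, …`. -/
theorem ae_tendsto_average_iterate [IsProbabilityMeasure μ] (hT : Ergodic T μ)
    {𝕜 : Type*} [RCLike 𝕜] {f : X → 𝕜} (hf : Integrable f μ) :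
    ∀ᵐ x ∂μ, Tendsto (fun K : ℕ => (1 / (K : 𝕜)) * ∑ n ∈ Finset.Icc 1 K, f (T^[n] x)) atTop
      (𝓝 (∫ y, f y ∂μ)) := by
  have hre := ae_tendsto_birkhoffAverage_real hT hf.re
  have him := ae_tendsto_birkhoffAverage_real hT hf.im
  filter_upwards [hT.quasiMeasurePreserving.ae hre, hT.quasiMeasurePreserving.ae him]
    with x hx1 hx2
  have h := ((RCLike.continuous_ofReal (K := 𝕜)).tendsto _ |>.comp hx1).add
    (((RCLike.continuous_ofReal (K := 𝕜)).tendsto _ |>.comp hx2).mul_const (RCLike.I : 𝕜))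
  rw [integral_re_add_im hf] at h
  refine h.congr fun K => ?_
  have hsum : ∑ n ∈ Finset.Icc 1 K, f (T^[n] x) = ∑ n ∈ Finset.range K, f (T^[n] (T x)) := by
    rw [Finset.range_eq_Ico, ← Finset.Ico_add_one_right_eq_Icc, ← zero_add 1,
      ← Finset.sum_Ico_add']
    simp [Function.iterate_succ_apply]
  rw [hsum]
  simp only [Function.comp, birkhoffAverage, birkhoffSum, smul_eq_mul, RCLike.ofReal_mul,
    RCLike.ofReal_inv, RCLike.ofReal_natCast, RCLike.ofReal_sum, one_div]
  rw [mul_assoc, ← mul_add, Finset.sum_mul, ← Finset.sum_add_distrib]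
  simp only [RCLike.re_add_im]

end Birkhoff

/-! ### Weighted averages of a sequence -/

/-- The weights `g n - L` are `o(L)` in mean, which handles the bounded part of `a`. On the part of
`a` above a height `M` they are at most `(C + 1) L + C b n`: the first summand costs a multiple of
the small tail average `τ M`, the second one is negligible as `∑ b n ‖a n‖ / n` converges. -/
lemma tendsto_sum_sub_mul_div {𝕜 : Type*} [RCLike 𝕜] {g : ℕ → ℕ} {L b τ : ℕ → ℝ} {C : ℝ}
    {a : ℕ → 𝕜} (hC : 0 ≤ C) (hL : Tendsto L atTop atTop)
    (hdev : Tendsto (fun K : ℕ => (∑ n ∈ Finset.Icc 1 K, |(g n : ℝ) - L K|) / (K * L K))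
      atTop (𝓝 0))
    (hb : ∀ n, 0 ≤ b n)
    (hgb : ∀ᶠ K in atTop, ∀ n ∈ Finset.Icc 1 K, (g n : ℝ) ≤ C * (L K + b n))
    (hτ0 : Tendsto τ atTop (𝓝 0))
    (hτ : ∀ M : ℕ, Tendsto (fun K : ℕ => (1 / (K : ℝ)) *
      ∑ n ∈ Finset.Icc 1 K, {z : 𝕜 | (M : ℝ) < ‖z‖}.indicator (fun z => ‖z‖) (a n)) atTop
      (𝓝 (τ M)))
    (hsum : Summable fun n : ℕ => b n / n * ‖a n‖) :
    Tendsto (fun K : ℕ => (1 / (K * L K)) *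
      ‖∑ n ∈ Finset.Icc 1 K, ((g n : 𝕜) - (L K : 𝕜)) * a n‖) atTop (𝓝 0) := by
  set B := ∑' n : ℕ, b n / n * ‖a n‖
  have hbound : ∀ M : ℕ, ∀ᶠ K : ℕ in atTop, (1 / (K * L K)) *
      ‖∑ n ∈ Finset.Icc 1 K, ((g n : 𝕜) - (L K : 𝕜)) * a n‖ ≤
      M * ((∑ n ∈ Finset.Icc 1 K, |(g n : ℝ) - L K|) / (K * L K)) +
      (C + 1) * ((1 / (K : ℝ)) * ∑ n ∈ Finset.Icc 1 K,
        {z : 𝕜 | (M : ℝ) < ‖z‖}.indicator (fun z => ‖z‖) (a n)) + C * B / L K := by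
    intro M
    filter_upwards [hgb, hL.eventually_gt_atTop 0, eventually_gt_atTop 0] with K hK hLK hK0
    have hK0' : (0 : ℝ) < K := Nat.cast_pos.2 hK0
    have hbsum : ∑ n ∈ Finset.Icc 1 K, b n * ‖a n‖ ≤ K * B := by
      calc ∑ n ∈ Finset.Icc 1 K, b n * ‖a n‖
          ≤ ∑ n ∈ Finset.Icc 1 K, K * (b n / n * ‖a n‖) := by
            refine Finset.sum_le_sum fun n hn => ?_
            obtain ⟨hn1, hnK⟩ := Finset.mem_Icc.1 hn
            have hn0 : (0 : ℝ) < n := by exact_mod_cast hn1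
            have : (n : ℝ) ≤ K := by exact_mod_cast hnK
            calc b n * ‖a n‖ = n * (b n / n * ‖a n‖) := by field_simp
              _ ≤ K * (b n / n * ‖a n‖) := by
                have := hb n
                gcongr
        _ = K * ∑ n ∈ Finset.Icc 1 K, (b n / n * ‖a n‖) := by rw [Finset.mul_sum]
        _ ≤ K * B := by
            gcongr
            exact hsum.sum_le_tsum _ fun n _ => by have := hb n; positivity
    have hterm : ∀ n ∈ Finset.Icc 1 K, ‖((g n : 𝕜) - (L K : 𝕜)) * a n‖ ≤
        M * |(g n : ℝ) - L K| + (C + 1) * L K *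
          {z : 𝕜 | (M : ℝ) < ‖z‖}.indicator (fun z => ‖z‖) (a n) + C * (b n * ‖a n‖) := by
      intro n hn
      have hcast : ((g n : 𝕜) - (L K : 𝕜)) = (((g n : ℝ) - L K : ℝ) : 𝕜) := by push_cast; rfl
      rw [norm_mul, hcast, RCLike.norm_ofReal]
      have hbn := hb n
      by_cases hM : (M : ℝ) < ‖a n‖
      · rw [Set.indicator_of_mem (show a n ∈ {z : 𝕜 | (M : ℝ) < ‖z‖} from hM)]
        have habs : |(g n : ℝ) - L K| ≤ (C + 1) * L K + C * b n := by
          have h1 := hK n hn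
          have h2 : (0 : ℝ) ≤ g n := Nat.cast_nonneg _
          have h3 : 0 ≤ C * b n := by positivity
          have h4 : 0 ≤ C * L K := by positivity
          rw [abs_le]; constructor <;> linarith
        have h5 : 0 ≤ (M : ℝ) * |(g n : ℝ) - L K| := by positivity
        have h6 := mul_le_mul_of_nonneg_right habs (norm_nonneg (a n))
        linarith
      · rw [Set.indicator_of_notMem (show a n ∉ {z : 𝕜 | (M : ℝ) < ‖z‖} from hM)]
        have h5 := mul_le_mul_of_nonneg_left (not_lt.1 hM) (abs_nonneg ((g n : ℝ) - L K))
        have h6 : 0 ≤ C * (b n * ‖a n‖) := by positivity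
        linarith
    calc (1 / (K * L K)) * ‖∑ n ∈ Finset.Icc 1 K, ((g n : 𝕜) - (L K : 𝕜)) * a n‖
        ≤ (1 / (K * L K)) * (M * (∑ n ∈ Finset.Icc 1 K, |(g n : ℝ) - L K|) +
          (C + 1) * L K * (∑ n ∈ Finset.Icc 1 K,
            {z : 𝕜 | (M : ℝ) < ‖z‖}.indicator (fun z => ‖z‖) (a n)) + C * (K * B)) := by
          gcongr
          refine (norm_sum_le_of_le _ hterm).trans ?_
          rw [Finset.sum_add_distrib, Finset.sum_add_distrib, ← Finset.mul_sum, ← Finset.mul_sum,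
            ← Finset.mul_sum]
          gcongr
      _ = _ := by field_simp
  have hlim : ∀ M : ℕ, Tendsto (fun K : ℕ =>
      M * ((∑ n ∈ Finset.Icc 1 K, |(g n : ℝ) - L K|) / (K * L K)) +
      (C + 1) * ((1 / (K : ℝ)) * ∑ n ∈ Finset.Icc 1 K,
        {z : 𝕜 | (M : ℝ) < ‖z‖}.indicator (fun z => ‖z‖) (a n)) + C * B / L K) atTop
      (𝓝 ((C + 1) * τ M)) := by
    intro M
    have := ((hdev.const_mul (M : ℝ)).add ((hτ M).const_mul (C + 1))).add
      (hL.const_div_atTop (C * B))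
    simpa using this
  rw [Metric.tendsto_nhds]
  intro ε hε
  have hτε : ∀ᶠ M in atTop, (C + 1) * τ M < ε := by
    have := hτ0.const_mul (C + 1)
    rw [mul_zero] at this
    exact this.eventually_lt_const hε
  obtain ⟨M, hM⟩ := hτε.exists
  filter_upwards [hbound M, (hlim M).eventually_lt_const hM, hL.eventually_gt_atTop 0]
    with K h1 h2 h3
  rw [Real.dist_0_eq_abs, abs_of_nonneg (by positivity)]
  exact h1.trans_lt h2

/-- Asymptotics of the total weight: `S_{g,K} ~ K * L K`. -/
lemma tendsto_weightSum_div {g : ℕ → ℕ} {L : ℕ → ℝ} (hL : Tendsto L atTop atTop)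
    (hdev : Tendsto (fun K : ℕ => (∑ n ∈ Finset.Icc 1 K, |(g n : ℝ) - L K|) / (K * L K))
      atTop (𝓝 0)) :
    Tendsto (fun K : ℕ => (weightSum g K : ℝ) / (K * L K)) atTop (𝓝 1) := by
  rw [tendsto_iff_norm_sub_tendsto_zero]
  refine squeeze_zero' (Eventually.of_forall fun _ => norm_nonneg _) ?_ hdev
  filter_upwards [hL.eventually_gt_atTop 0, eventually_gt_atTop 0] with K hLK hK0
  have hK0' : (0 : ℝ) < K := Nat.cast_pos.2 hK0
  have : (weightSum g K : ℝ) / (K * L K) - 1 =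
      (∑ n ∈ Finset.Icc 1 K, ((g n : ℝ) - L K)) / (K * L K) := by
    rw [Finset.sum_sub_distrib, weightSum]
    push_cast
    rw [Finset.sum_const, Nat.card_Icc, nsmul_eq_mul, Nat.add_sub_cancel, sub_div, div_self]
    positivity
  rw [this, norm_div, Real.norm_of_nonneg (show 0 ≤ (K : ℝ) * L K by positivity)]
  gcongr
  exact norm_sum_le _ _

/-- If the ordinary averages of a sequence converge, its weighted averages converge to the same
limit when the weights are concentrated around a mean `L K` that tends to infinity, provided that
large weights are rare along the sequence and that the sequence is uniformly integrable in mean. -/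
theorem tendsto_weighted_average {𝕜 : Type*} [RCLike 𝕜] {g : ℕ → ℕ} {L b τ : ℕ → ℝ} {C : ℝ}
    {a : ℕ → 𝕜} {α : 𝕜} (hC : 0 ≤ C) (hL : Tendsto L atTop atTop)
    (hdev : Tendsto (fun K : ℕ => (∑ n ∈ Finset.Icc 1 K, |(g n : ℝ) - L K|) / (K * L K))
      atTop (𝓝 0))
    (hb : ∀ n, 0 ≤ b n)
    (hgb : ∀ᶠ K in atTop, ∀ n ∈ Finset.Icc 1 K, (g n : ℝ) ≤ C * (L K + b n))
    (ha : Tendsto (fun K : ℕ => (1 / (K : 𝕜)) * ∑ n ∈ Finset.Icc 1 K, a n) atTop (𝓝 α))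
    (hτ0 : Tendsto τ atTop (𝓝 0))
    (hτ : ∀ M : ℕ, Tendsto (fun K : ℕ => (1 / (K : ℝ)) *
      ∑ n ∈ Finset.Icc 1 K, {z : 𝕜 | (M : ℝ) < ‖z‖}.indicator (fun z => ‖z‖) (a n)) atTop
      (𝓝 (τ M)))
    (hsum : Summable fun n : ℕ => b n / n * ‖a n‖) :
    Tendsto (fun K : ℕ => (1 / (weightSum g K : 𝕜)) * ∑ n ∈ Finset.Icc 1 K, (g n : 𝕜) * a n)
      atTop (𝓝 α) := by
  have hS := tendsto_weightSum_div hL hdev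
  have hD := tendsto_sum_sub_mul_div hC hL hdev hb hgb hτ0 hτ hsum
  have hD' : Tendsto (fun K : ℕ => (1 / ((K : 𝕜) * (L K : 𝕜))) *
      ∑ n ∈ Finset.Icc 1 K, ((g n : 𝕜) - (L K : 𝕜)) * a n) atTop (𝓝 0) := by
    rw [tendsto_zero_iff_norm_tendsto_zero]
    refine hD.congr' ?_
    filter_upwards [hL.eventually_gt_atTop 0] with K hLK
    rw [norm_mul, norm_div, norm_mul, RCLike.norm_natCast, RCLike.norm_ofReal, norm_one,
      abs_of_pos hLK]
  have hS' : Tendsto (fun K : ℕ => (((weightSum g K : ℝ) / (K * L K) : ℝ) : 𝕜)) atTop (𝓝 1) := by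
    have := (RCLike.continuous_ofReal (K := 𝕜)).tendsto _ |>.comp hS
    rwa [RCLike.ofReal_one] at this
  have h := (ha.add hD').div hS' one_ne_zero
  rw [add_zero, div_one] at h
  refine h.congr' ?_
  filter_upwards [hL.eventually_gt_atTop 0, eventually_gt_atTop 0,
    hS.eventually_const_lt zero_lt_one] with K hLK hK0 hSK
  have hK0' : (K : 𝕜) ≠ 0 := by exact_mod_cast hK0.ne'
  have hLK' : (L K : 𝕜) ≠ 0 := by exact_mod_cast hLK.ne'
  have hSK' : (weightSum g K : 𝕜) ≠ 0 := by
    intro h0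
    have : weightSum g K = 0 := by exact_mod_cast h0
    simp [this] at hSK
  have hsplit : ∑ n ∈ Finset.Icc 1 K, ((g n : 𝕜) - (L K : 𝕜)) * a n =
      ∑ n ∈ Finset.Icc 1 K, (g n : 𝕜) * a n - (L K : 𝕜) * ∑ n ∈ Finset.Icc 1 K, a n := by
    rw [Finset.mul_sum, ← Finset.sum_sub_distrib]
    simp only [sub_mul]
  simp only [Pi.div_apply, hsplit]
  push_cast
  field_simp
  ring

/-! ### Sums over the decomposition of an integer as a square times a squarefree integer -/

lemma sum_le_sum_of_forall_exists_eq {ι κ : Type*} [DecidableEq κ] {A : Finset κ}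
    {P : Finset ι} {φ : ι → κ} {F : κ → ℝ} (hF : ∀ i ∈ P, 0 ≤ F (φ i))
    (h : ∀ n ∈ A, ∃ i ∈ P, φ i = n) : ∑ n ∈ A, F n ≤ ∑ i ∈ P, F (φ i) := by
  calc ∑ n ∈ A, F n ≤ ∑ n ∈ A, ∑ i ∈ P with φ i = n, F (φ i) := by
        refine Finset.sum_le_sum fun n hn => ?_
        obtain ⟨i, hi, rfl⟩ := h n hn
        exact Finset.single_le_sum (f := fun i => F (φ i))
          (fun j hj => hF j (Finset.mem_filter.1 hj).1) (Finset.mem_filter.2 ⟨hi, rfl⟩)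
    _ = ∑ i ∈ P with φ i ∈ A, F (φ i) := by
        simp_rw [Finset.sum_filter]
        rw [Finset.sum_comm]
        simp
    _ ≤ ∑ i ∈ P, F (φ i) :=
        Finset.sum_le_sum_of_subset_of_nonneg (Finset.filter_subset _ _) fun i hi _ => hF i hi

lemma exists_sq_mul_squarefree_of_mem_Icc {n N : ℕ} (hn : n ∈ Finset.Icc 1 N) :
    ∃ q ∈ Finset.Icc 1 N, ∃ s ∈ (Finset.Icc 1 N).filter Squarefree, q ^ 2 * s = n := by
  obtain ⟨hn1, hnN⟩ := Finset.mem_Icc.1 hn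
  obtain ⟨s, q, hs, hq, h, hsq⟩ := Nat.sq_mul_squarefree_of_pos hn1
  refine ⟨q, Finset.mem_Icc.2 ⟨hq, ?_⟩, s, Finset.mem_filter.2 ⟨Finset.mem_Icc.2 ⟨hs, ?_⟩, hsq⟩, h⟩
  · calc q ≤ q ^ 2 * s := by nlinarith [Nat.le_self_pow two_ne_zero q, pow_pos hq 2]
      _ ≤ N := h ▸ hnN
  · calc s ≤ q ^ 2 * s := by nlinarith [pow_pos hq 2]
      _ ≤ N := h ▸ hnN

lemma sum_Icc_le_sum_sq_mul_squarefree {F : ℕ → ℝ} (hF : ∀ n, 0 ≤ F n) (N : ℕ) :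
    ∑ n ∈ Finset.Icc 1 N, F n ≤
      ∑ q ∈ Finset.Icc 1 N, ∑ s ∈ (Finset.Icc 1 N).filter Squarefree, F (q ^ 2 * s) := by
  rw [← Finset.sum_product']
  refine sum_le_sum_of_forall_exists_eq (φ := fun x : ℕ × ℕ => x.1 ^ 2 * x.2)
    (fun _ _ => hF _) fun n hn => ?_
  obtain ⟨q, hq, s, hs, h⟩ := exists_sq_mul_squarefree_of_mem_Icc hn
  exact ⟨(q, s), Finset.mem_product.2 ⟨hq, hs⟩, h⟩

/-! ### The sum of the reciprocals of the primes -/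

/-- The sum `∑_{p ≤ K} 1 / p` over the primes, which is the mean order of `ω` and `Ω`. -/
noncomputable def primeReciprocalSum (K : ℕ) : ℝ :=
  ∑ p ∈ (Finset.Icc 1 K).filter Nat.Prime, 1 / (p : ℝ)

lemma primeReciprocalSum_nonneg (K : ℕ) : 0 ≤ primeReciprocalSum K :=
  Finset.sum_nonneg fun _ _ => by positivity

lemma sum_squarefree_one_div_le (N : ℕ) :
    ∑ s ∈ (Finset.Icc 1 N).filter Squarefree, 1 / (s : ℝ) ≤ Real.exp (primeReciprocalSum N) := by
  calc ∑ s ∈ (Finset.Icc 1 N).filter Squarefree, 1 / (s : ℝ)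
      ≤ ∑ t ∈ ((Finset.Icc 1 N).filter Nat.Prime).powerset, 1 / ((∏ p ∈ t, p : ℕ) : ℝ) := by
        refine sum_le_sum_of_forall_exists_eq (F := fun s : ℕ => 1 / (s : ℝ))
          (φ := fun t : Finset ℕ => ∏ p ∈ t, p) (fun _ _ => by positivity) fun s hs => ?_
        obtain ⟨hs1, hs2⟩ := Finset.mem_filter.1 hs
        refine ⟨s.primeFactors, Finset.mem_powerset.2 fun p hp => ?_,
          Nat.prod_primeFactors_of_squarefree hs2⟩
        obtain ⟨hp1, hp2, hp3⟩ := Nat.mem_primeFactors.1 hp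
        exact Finset.mem_filter.2 ⟨Finset.mem_Icc.2 ⟨hp1.one_le,
          (Nat.le_of_dvd (Nat.pos_of_ne_zero hp3) hp2).trans (Finset.mem_Icc.1 hs1).2⟩, hp1⟩
    _ = ∏ p ∈ (Finset.Icc 1 N).filter Nat.Prime, (1 + 1 / (p : ℝ)) := by
        rw [Finset.prod_one_add]
        simp
    _ ≤ Real.exp (primeReciprocalSum N) := by
        rw [primeReciprocalSum, Real.exp_sum]
        refine Finset.prod_le_prod (fun _ _ => by positivity) fun p _ => ?_
        rw [add_comm]
        exact Real.add_one_le_exp _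

lemma natCast_harmonic_eq (N : ℕ) :
    ((harmonic N : ℚ) : ℝ) = ∑ n ∈ Finset.Icc 1 N, 1 / (n : ℝ) := by
  simp [harmonic_eq_sum_Icc]

/-- A lower bound of the right order: writing `n = q² s` with `s` squarefree bounds the harmonic sum
by `∑ 1 / q² · ∏ (1 + 1 / p)`. -/
lemma exists_log_natLog_le_primeReciprocalSum_add :
    ∃ C : ℝ, ∀ K : ℕ, 2 ≤ K → Real.log (Nat.log 2 K) ≤ primeReciprocalSum K + C := by
  have hs : Summable fun q : ℕ => 1 / (q : ℝ) ^ 2 := Real.summable_one_div_nat_pow.2 one_lt_two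
  set A := ∑' q : ℕ, 1 / (q : ℝ) ^ 2 with hA
  have hA1 : 1 ≤ A := by
    have := hs.le_tsum 1 fun _ _ => by positivity
    simpa [hA] using this
  refine ⟨Real.log (A / Real.log 2), fun K hK => ?_⟩
  have hlog2 : 0 < Real.log 2 := Real.log_pos one_lt_two
  have h1 : Real.log K ≤ A * Real.exp (primeReciprocalSum K) := by
    calc Real.log K ≤ Real.log (K + 1 : ℕ) := by
          apply Real.log_le_log
          · exact_mod_cast (by omega : 0 < K)
          · exact_mod_cast Nat.le_succ K
      _ ≤ ∑ n ∈ Finset.Icc 1 K, 1 / (n : ℝ) := by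
          rw [← natCast_harmonic_eq]; exact log_add_one_le_harmonic K
      _ ≤ ∑ q ∈ Finset.Icc 1 K, ∑ s ∈ (Finset.Icc 1 K).filter Squarefree,
            1 / ((q ^ 2 * s : ℕ) : ℝ) :=
          sum_Icc_le_sum_sq_mul_squarefree (F := fun n : ℕ => 1 / (n : ℝ))
            (fun _ => by positivity) K
      _ = (∑ q ∈ Finset.Icc 1 K, 1 / (q : ℝ) ^ 2) *
            ∑ s ∈ (Finset.Icc 1 K).filter Squarefree, 1 / (s : ℝ) := by
          rw [Finset.sum_mul_sum]
          refine Finset.sum_congr rfl fun q _ => Finset.sum_congr rfl fun s _ => ?_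
          push_cast
          rw [div_mul_div_comm, one_mul]
      _ ≤ A * Real.exp (primeReciprocalSum K) :=
          mul_le_mul (hs.sum_le_tsum _ fun _ _ => by positivity) (sum_squarefree_one_div_le K)
            (Finset.sum_nonneg fun _ _ => by positivity) (by linarith)
  have h2 : (Nat.log 2 K : ℝ) ≤ A / Real.log 2 * Real.exp (primeReciprocalSum K) := by
    have h3 : (Nat.log 2 K : ℝ) ≤ Real.log K / Real.log 2 := by
      have := Real.natLog_le_logb K 2
      simpa [Real.logb] using this
    refine h3.trans ?_
    rw [div_mul_eq_mul_div]
    gcongr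
  have h4 : (0 : ℝ) < Nat.log 2 K := by exact_mod_cast Nat.log_pos one_lt_two hK
  calc Real.log (Nat.log 2 K) ≤ Real.log (A / Real.log 2 * Real.exp (primeReciprocalSum K)) :=
        Real.log_le_log h4 h2
    _ = primeReciprocalSum K + Real.log (A / Real.log 2) := by
        rw [Real.log_mul (by positivity) (by positivity), Real.log_exp, add_comm]

lemma tendsto_primeReciprocalSum_atTop : Tendsto primeReciprocalSum atTop atTop := by
  obtain ⟨C, hC⟩ := exists_log_natLog_le_primeReciprocalSum_add
  have hlog : Tendsto (Nat.log 2) atTop atTop := by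
    refine tendsto_atTop_atTop.2 fun b => ⟨2 ^ b, fun n hn => ?_⟩
    exact Nat.le_log_of_pow_le one_lt_two hn
  have h : Tendsto (fun K : ℕ => Real.log (Nat.log 2 K) - C) atTop atTop :=
    tendsto_atTop_add_const_right _ _
      (Real.tendsto_log_atTop.comp (tendsto_natCast_atTop_atTop.comp hlog))
  refine tendsto_atTop_mono' _ ?_ h
  filter_upwards [eventually_ge_atTop 2] with K hK
  linarith [hC K hK]

/-! ### Concentration of the prime divisor functions around their mean -/

lemma cardDistinctFactors_eq_sum_ite {n K : ℕ} (hn : n ∈ Finset.Icc 1 K) :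
    (cardDistinctFactors n : ℝ) =
      ∑ p ∈ (Finset.Icc 1 K).filter Nat.Prime, if p ∣ n then (1 : ℝ) else 0 := by
  have h : n.primeFactors = ((Finset.Icc 1 K).filter Nat.Prime).filter (· ∣ n) := by
    ext p
    obtain ⟨hn1, hnK⟩ := Finset.mem_Icc.1 hn
    simp only [Nat.mem_primeFactors, Finset.mem_filter, Finset.mem_Icc]
    constructor
    · rintro ⟨hp, hpn, -⟩
      exact ⟨⟨⟨hp.one_le, (Nat.le_of_dvd hn1 hpn).trans hnK⟩, hp⟩, hpn⟩
    · rintro ⟨⟨-, hp⟩, hpn⟩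
      exact ⟨hp, hpn, by omega⟩
  rw [Finset.sum_ite, Finset.sum_const_zero, add_zero, Finset.sum_const, nsmul_eq_mul, mul_one, ← h,
    ArithmeticFunction.cardDistinctFactors_apply, Nat.primeFactors, List.card_toFinset]

lemma sum_Icc_ite_dvd (K d : ℕ) :
    ∑ n ∈ Finset.Icc 1 K, (if d ∣ n then (1 : ℝ) else 0) = (K / d : ℕ) := by
  rw [Finset.sum_ite, Finset.sum_const_zero, add_zero, Finset.sum_const, nsmul_eq_mul, mul_one,
    ← Nat.Ioc_filter_dvd_card_eq_div]
  rfl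

/-- Turán's second moment estimate. The lower bound for the first moment loses at most `1` for
each prime `p ≤ K`, hence at most `K` in total. -/
lemma sum_sq_cardDistinctFactors_sub_le (K : ℕ) :
    ∑ n ∈ Finset.Icc 1 K, ((cardDistinctFactors n : ℝ) - primeReciprocalSum K) ^ 2 ≤
      3 * K * primeReciprocalSum K := by
  set P := (Finset.Icc 1 K).filter Nat.Prime with hP
  set L := primeReciprocalSum K with hL
  have hL0 : 0 ≤ L := primeReciprocalSum_nonneg K
  have hfirst : K * L - K ≤ ∑ n ∈ Finset.Icc 1 K, (cardDistinctFactors n : ℝ) := by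
    have h1 : ∑ n ∈ Finset.Icc 1 K, (cardDistinctFactors n : ℝ) = ∑ p ∈ P, ((K / p : ℕ) : ℝ) := by
      rw [Finset.sum_congr rfl fun n hn => cardDistinctFactors_eq_sum_ite hn, Finset.sum_comm]
      simp_rw [sum_Icc_ite_dvd]
      rfl
    have h2 : ∑ p ∈ P, ((K : ℝ) * (1 / p) - 1) ≤ ∑ p ∈ P, ((K / p : ℕ) : ℝ) := by
      refine Finset.sum_le_sum fun p hp => ?_
      have hp0 : 0 < p := (Finset.mem_filter.1 hp).2.pos
      have hp0' : (0 : ℝ) < p := Nat.cast_pos.2 hp0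
      have h3 : (K : ℝ) < p * ((K / p : ℕ) + 1) := by
        exact_mod_cast Nat.lt_mul_div_succ K hp0
      rw [mul_one_div, sub_le_iff_le_add, div_le_iff₀ hp0']
      linarith
    have h3 : (P.card : ℝ) ≤ K := by
      have := Finset.card_filter_le (Finset.Icc 1 K) Nat.Prime
      rw [Nat.card_Icc, Nat.add_sub_cancel] at this
      exact_mod_cast this
    rw [Finset.sum_sub_distrib, ← Finset.mul_sum, Finset.sum_const, nsmul_eq_mul, mul_one] at h2
    rw [h1, hL, primeReciprocalSum]
    linarith
  have hsecond : ∑ n ∈ Finset.Icc 1 K, (cardDistinctFactors n : ℝ) ^ 2 ≤ K * L ^ 2 + K * L := by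
    have h1 : ∑ n ∈ Finset.Icc 1 K, (cardDistinctFactors n : ℝ) ^ 2 =
        ∑ p ∈ P, ∑ q ∈ P, ∑ n ∈ Finset.Icc 1 K,
          (if p ∣ n then (1 : ℝ) else 0) * (if q ∣ n then (1 : ℝ) else 0) := by
      rw [Finset.sum_congr rfl fun n hn => by
        rw [cardDistinctFactors_eq_sum_ite hn, sq, Finset.sum_mul_sum], Finset.sum_comm]
      exact Finset.sum_congr rfl fun p _ => Finset.sum_comm
    have h2 : ∀ p ∈ P, ∀ q ∈ P, ∑ n ∈ Finset.Icc 1 K,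
        (if p ∣ n then (1 : ℝ) else 0) * (if q ∣ n then (1 : ℝ) else 0) ≤
        K * ((1 / p) * (1 / q)) + if p = q then (K : ℝ) * (1 / p) else 0 := by
      intro p hp q hq
      have hp' := (Finset.mem_filter.1 hp).2
      have hq' := (Finset.mem_filter.1 hq).2
      have h3 : ∀ n : ℕ, (if p ∣ n then (1 : ℝ) else 0) * (if q ∣ n then (1 : ℝ) else 0) =
          if p.lcm q ∣ n then 1 else 0 := by
        intro n
        simp only [Nat.lcm_dvd_iff, ite_and]
        split_ifs <;> simp
      simp_rw [h3]
      rw [sum_Icc_ite_dvd]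
      by_cases hpq : p = q
      · subst hpq
        rw [if_pos rfl, Nat.lcm_self]
        have := Nat.cast_div_le (α := ℝ) (m := K) (n := p)
        have h0 : (0 : ℝ) ≤ K * ((1 / p) * (1 / p)) := by positivity
        rw [mul_one_div (K : ℝ) (p : ℝ)]
        linarith
      · rw [if_neg hpq, add_zero, ((Nat.coprime_primes hp' hq').2 hpq).lcm_eq_mul]
        refine Nat.cast_div_le.trans_eq ?_
        push_cast
        rw [div_mul_div_comm, one_mul, mul_one_div]
    rw [h1]
    refine (Finset.sum_le_sum fun p hp => Finset.sum_le_sum fun q hq => h2 p hp q hq).trans_eq ?_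
    simp_rw [Finset.sum_add_distrib, ← Finset.mul_sum]
    rw [← Finset.sum_mul, sq, hL, primeReciprocalSum, Finset.mul_sum (a := (K : ℝ))]
    congr 1
    · refine Finset.sum_congr rfl fun p hp => ?_
      rw [Finset.sum_ite_eq, if_pos hp]
  calc ∑ n ∈ Finset.Icc 1 K, ((cardDistinctFactors n : ℝ) - L) ^ 2
      = ∑ n ∈ Finset.Icc 1 K, (cardDistinctFactors n : ℝ) ^ 2 -
        2 * L * ∑ n ∈ Finset.Icc 1 K, (cardDistinctFactors n : ℝ) + K * L ^ 2 := by
        simp_rw [sub_sq]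
        rw [Finset.sum_add_distrib, Finset.sum_sub_distrib, Finset.sum_const, Nat.card_Icc,
          Nat.add_sub_cancel, nsmul_eq_mul, Finset.mul_sum]
        congr 2
        exact Finset.sum_congr rfl fun n _ => by ring
    _ ≤ 3 * K * L := by nlinarith [mul_le_mul_of_nonneg_left hfirst hL0]

lemma sum_abs_cardDistinctFactors_sub_le (K : ℕ) :
    ∑ n ∈ Finset.Icc 1 K, |(cardDistinctFactors n : ℝ) - primeReciprocalSum K| ≤
      K * √(3 * primeReciprocalSum K) := by
  have hL0 := primeReciprocalSum_nonneg K
  rw [← abs_of_nonneg (Finset.sum_nonneg fun _ _ => abs_nonneg _ :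
    0 ≤ ∑ n ∈ Finset.Icc 1 K, |(cardDistinctFactors n : ℝ) - primeReciprocalSum K|)]
  refine abs_le_of_sq_le_sq ?_ (by positivity)
  refine (sq_sum_le_card_mul_sum_sq (s := Finset.Icc 1 K)).trans ?_
  simp_rw [sq_abs]
  rw [mul_pow, Real.sq_sqrt (by positivity), Nat.card_Icc, Nat.add_sub_cancel]
  calc (K : ℝ) * _ ≤ K * (3 * K * primeReciprocalSum K) := by
        gcongr; exact sum_sq_cardDistinctFactors_sub_le K
    _ = _ := by ring

lemma two_pow_cardFactors_le {n : ℕ} (hn : n ≠ 0) : 2 ^ cardFactors n ≤ n := by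
  calc 2 ^ cardFactors n ≤ n.primeFactorsList.prod := by
        rw [ArithmeticFunction.cardFactors_apply]
        exact List.pow_card_le_prod _ _ fun p hp => (Nat.prime_of_mem_primeFactorsList hp).two_le
    _ = n := Nat.prod_primeFactorsList hn

lemma sqrt_two_pow_cardFactors_le (n : ℕ) (hn : n ≠ 0) : √2 ^ cardFactors n ≤ √(n : ℝ) := by
  refine Real.le_sqrt_of_sq_le ?_
  rw [← pow_mul, mul_comm, pow_mul, Real.sq_sqrt zero_le_two]
  exact_mod_cast two_pow_cardFactors_le hn

lemma cardFactors_le_four_mul_sqrt (n : ℕ) : (cardFactors n : ℝ) ≤ 4 * √(n : ℝ) := by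
  rcases eq_or_ne n 0 with rfl | hn
  · simp
  -- Bernoulli's inequality for `√2 ^ Ω(n) ≤ √n`, with `√2 - 1 ≥ 1 / 4`.
  have h1 : (5 / 4 : ℝ) ≤ √2 := Real.le_sqrt_of_sq_le (by norm_num)
  have h2 := one_add_mul_sub_le_pow (by linarith : (-1 : ℝ) ≤ √2) (cardFactors n)
  have h3 := sqrt_two_pow_cardFactors_le n hn
  have h4 : (0 : ℝ) ≤ cardFactors n := Nat.cast_nonneg _
  nlinarith

lemma cardDistinctFactors_le_cardFactors (n : ℕ) : cardDistinctFactors n ≤ cardFactors n := by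
  rw [ArithmeticFunction.cardDistinctFactors_apply, ArithmeticFunction.cardFactors_apply]
  exact (List.dedup_sublist _).length_le

lemma cardFactors_le_cardDistinctFactors_add {q s : ℕ} (hq : q ≠ 0) (hs : Squarefree s) :
    cardFactors (q ^ 2 * s) ≤ cardDistinctFactors (q ^ 2 * s) + 2 * cardFactors q := by
  have hs0 : s ≠ 0 := hs.ne_zero
  have h1 : cardFactors s ≤ cardDistinctFactors (q ^ 2 * s) := by
    rw [← (ArithmeticFunction.cardDistinctFactors_eq_cardFactors_iff_squarefree hs0).2 hs]
    simp only [ArithmeticFunction.cardDistinctFactors_apply, ← List.card_toFinset]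
    exact Finset.card_le_card
      (Nat.primeFactors_mono (dvd_mul_left s (q ^ 2)) (mul_ne_zero (pow_ne_zero 2 hq) hs0))
  rw [ArithmeticFunction.cardFactors_mul (pow_ne_zero 2 hq) hs0, ArithmeticFunction.cardFactors_pow]
  omega

/-- Multiplicities contribute only `O(K)`: they are carried by the square part `q²` of `n = q² s`,
and at most `K / q²` integers up to `K` are divisible by `q²`. -/
lemma exists_sum_cardFactors_sub_le :
    ∃ C : ℝ, ∀ K : ℕ, ∑ n ∈ Finset.Icc 1 K,
      ((cardFactors n : ℝ) - cardDistinctFactors n) ≤ C * K := by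
  have hsum : Summable fun q : ℕ => 2 * (cardFactors q : ℝ) / (q : ℝ) ^ 2 := by
    refine Summable.of_nonneg_of_le (fun _ => by positivity) (fun q => ?_)
      ((Real.summable_one_div_nat_rpow.2 (by norm_num : (1 : ℝ) < 3 / 2)).mul_left 8)
    rcases Nat.eq_zero_or_pos q with rfl | hq
    · simp
    have hq' : (0 : ℝ) < q := Nat.cast_pos.2 hq
    have h1 := cardFactors_le_four_mul_sqrt q
    have h2 : √(q : ℝ) * (q : ℝ) ^ (3 / 2 : ℝ) = (q : ℝ) ^ 2 := by
      rw [Real.sqrt_eq_rpow, ← Real.rpow_add hq', ← Real.rpow_natCast]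
      norm_num
    have h3 : 0 < (q : ℝ) ^ (3 / 2 : ℝ) := Real.rpow_pos_of_pos hq' _
    rw [mul_one_div, div_le_div_iff₀ (by positivity) h3, ← h2]
    nlinarith
  refine ⟨∑' q : ℕ, 2 * (cardFactors q : ℝ) / (q : ℝ) ^ 2, fun K => ?_⟩
  calc ∑ n ∈ Finset.Icc 1 K, ((cardFactors n : ℝ) - cardDistinctFactors n)
      ≤ ∑ n ∈ Finset.Icc 1 K, ∑ q ∈ Finset.Icc 1 K,
          2 * (cardFactors q : ℝ) * (if q ^ 2 ∣ n then 1 else 0) := by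
        refine Finset.sum_le_sum fun n hn => ?_
        obtain ⟨q, hq, s, hs, rfl⟩ := exists_sq_mul_squarefree_of_mem_Icc hn
        have hq0 : q ≠ 0 := by have := (Finset.mem_Icc.1 hq).1; omega
        have h1 : (cardFactors (q ^ 2 * s) : ℝ) ≤
            cardDistinctFactors (q ^ 2 * s) + 2 * cardFactors q := by
          exact_mod_cast cardFactors_le_cardDistinctFactors_add hq0 (Finset.mem_filter.1 hs).2
        refine le_trans ?_ (Finset.single_le_sum (fun _ _ => by positivity) hq)
        rw [if_pos (dvd_mul_right _ _)]
        linarith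
    _ = ∑ q ∈ Finset.Icc 1 K, 2 * (cardFactors q : ℝ) * (K / q ^ 2 : ℕ) := by
        rw [Finset.sum_comm]
        simp_rw [← Finset.mul_sum, sum_Icc_ite_dvd]
    _ ≤ ∑ q ∈ Finset.Icc 1 K, (2 * (cardFactors q : ℝ) / (q : ℝ) ^ 2) * K := by
        refine Finset.sum_le_sum fun q _ => ?_
        rw [div_mul_eq_mul_div, mul_div_assoc]
        gcongr
        refine Nat.cast_div_le.trans_eq ?_
        push_cast
        rfl
    _ ≤ _ := by
        rw [← Finset.sum_mul]
        gcongr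
        exact hsum.sum_le_tsum _ fun _ _ => by positivity

/-- Both prime divisor functions lie between `ω` and `Ω`, which differ by `O(1)` in mean. -/
lemma tendsto_sum_abs_sub_primeReciprocalSum_div {g : ℕ → ℕ}
    (hlo : ∀ n, cardDistinctFactors n ≤ g n) (hup : ∀ n, g n ≤ cardFactors n) :
    Tendsto (fun K : ℕ => (∑ n ∈ Finset.Icc 1 K, |(g n : ℝ) - primeReciprocalSum K|) /
      (K * primeReciprocalSum K)) atTop (𝓝 0) := by
  obtain ⟨C, hC⟩ := exists_sum_cardFactors_sub_le
  have hL := tendsto_primeReciprocalSum_atTop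
  have hlim : Tendsto (fun K : ℕ => √3 / √(primeReciprocalSum K) + C / primeReciprocalSum K) atTop
      (𝓝 0) := by
    have := ((Real.tendsto_sqrt_atTop.comp hL).const_div_atTop (√3)).add (hL.const_div_atTop C)
    simpa using this
  refine squeeze_zero' (Eventually.of_forall fun K => ?_) ?_ hlim
  · have := primeReciprocalSum_nonneg K
    exact div_nonneg (Finset.sum_nonneg fun _ _ => abs_nonneg _) (by positivity)
  filter_upwards [hL.eventually_gt_atTop 0, eventually_gt_atTop 0] with K hLK hK0
  have hK0' : (0 : ℝ) < K := Nat.cast_pos.2 hK0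
  rw [div_le_iff₀ (by positivity)]
  have h1 : ∑ n ∈ Finset.Icc 1 K, |(g n : ℝ) - primeReciprocalSum K| ≤
      ∑ n ∈ Finset.Icc 1 K, |(cardDistinctFactors n : ℝ) - primeReciprocalSum K| +
      ∑ n ∈ Finset.Icc 1 K, ((cardFactors n : ℝ) - cardDistinctFactors n) := by
    rw [← Finset.sum_add_distrib]
    refine Finset.sum_le_sum fun n _ => ?_
    have h2 : (cardDistinctFactors n : ℝ) ≤ g n := by exact_mod_cast hlo n
    have h3 : (g n : ℝ) ≤ cardFactors n := by exact_mod_cast hup n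
    have h4 := abs_sub_le (g n : ℝ) (cardDistinctFactors n) (primeReciprocalSum K)
    rw [abs_of_nonneg (sub_nonneg.2 h2)] at h4
    linarith
  refine (h1.trans (add_le_add (sum_abs_cardDistinctFactors_sub_le K) (hC K))).trans_eq ?_
  rw [Real.sqrt_mul (by norm_num)]
  have h5 : √(primeReciprocalSum K) ≠ 0 := (Real.sqrt_pos.2 hLK).ne'
  have h6 : √(primeReciprocalSum K) * √(primeReciprocalSum K) = primeReciprocalSum K :=
    Real.mul_self_sqrt hLK.le
  field_simp
  linear_combination √3 * h6

/-! ### Large values of the prime divisor functions -/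

lemma two_pow_cardDistinctFactors_le_card_divisors {n : ℕ} (hn : n ≠ 0) :
    2 ^ cardDistinctFactors n ≤ n.divisors.card := by
  rw [Nat.card_divisors hn, ArithmeticFunction.cardDistinctFactors_apply, ← List.card_toFinset]
  refine Finset.pow_card_le_prod _ _ _ fun p hp => ?_
  have hp' := Nat.mem_primeFactors.1 hp
  have := hp'.1.factorization_pos_of_dvd hp'.2.2 hp'.2.1
  omega

lemma sum_card_divisors_div_le (N : ℕ) :
    ∑ s ∈ Finset.Icc 1 N, (s.divisors.card : ℝ) / s ≤ (∑ n ∈ Finset.Icc 1 N, 1 / (n : ℝ)) ^ 2 := by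
  calc ∑ s ∈ Finset.Icc 1 N, (s.divisors.card : ℝ) / s
      = ∑ s ∈ Finset.Icc 1 N, ∑ x ∈ Finset.Icc 1 N ×ˢ Finset.Icc 1 N with x.1 * x.2 = s,
          1 / (x.1 : ℝ) * (1 / x.2) := by
        refine Finset.sum_congr rfl fun s hs => ?_
        obtain ⟨hs1, hsN⟩ := Finset.mem_Icc.1 hs
        have h : ∀ x ∈ (Finset.Icc 1 N ×ˢ Finset.Icc 1 N).filter (fun x => x.1 * x.2 = s),
            1 / (x.1 : ℝ) * (1 / x.2) = 1 / s := by
          intro x hx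
          rw [← (Finset.mem_filter.1 hx).2, div_mul_div_comm, one_mul, Nat.cast_mul]
        rw [Finset.sum_congr rfl h, Finset.sum_const, nsmul_eq_mul, mul_one_div]
        congr 2
        have hcard : s.divisors.card = s.divisorsAntidiagonal.card := by
          rw [← Nat.map_div_right_divisors, Finset.card_map]
        rw [hcard, Nat.divisorsAntidiagonal_eq_prod_filter_of_le (by omega) hsN]
        rfl
    _ ≤ ∑ x ∈ Finset.Icc 1 N ×ˢ Finset.Icc 1 N, 1 / (x.1 : ℝ) * (1 / x.2) := by
        simp_rw [Finset.sum_filter]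
        rw [Finset.sum_comm]
        refine Finset.sum_le_sum fun x _ => ?_
        rw [Finset.sum_ite_eq]
        split_ifs
        · exact le_rfl
        · positivity
    _ = (∑ n ∈ Finset.Icc 1 N, 1 / (n : ℝ)) ^ 2 := by
        rw [sq, Finset.sum_mul_sum, Finset.sum_product]

/-- Rankin-type bound. The base `√2` is small enough that the square part `q²` of `n` contributes
only `2 ^ Ω(q) / q² ≤ 1 / q`. -/
lemma sum_sqrt_two_pow_cardFactors_div_le (N : ℕ) :
    ∑ n ∈ Finset.Icc 1 N, √2 ^ cardFactors n / n ≤ (∑ n ∈ Finset.Icc 1 N, 1 / (n : ℝ)) ^ 3 := by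
  calc ∑ n ∈ Finset.Icc 1 N, √2 ^ cardFactors n / n
      ≤ ∑ q ∈ Finset.Icc 1 N, ∑ s ∈ (Finset.Icc 1 N).filter Squarefree,
          √2 ^ cardFactors (q ^ 2 * s) / ((q ^ 2 * s : ℕ) : ℝ) :=
        sum_Icc_le_sum_sq_mul_squarefree (F := fun n : ℕ => √2 ^ cardFactors n / (n : ℝ))
          (fun _ => by positivity) N
    _ ≤ ∑ q ∈ Finset.Icc 1 N, ∑ s ∈ (Finset.Icc 1 N).filter Squarefree,
          1 / (q : ℝ) * ((s.divisors.card : ℝ) / s) := by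
        refine Finset.sum_le_sum fun q hq => Finset.sum_le_sum fun s hs => ?_
        have hq0 : q ≠ 0 := by have := (Finset.mem_Icc.1 hq).1; omega
        have hsq := (Finset.mem_filter.1 hs).2
        have hs0 : s ≠ 0 := hsq.ne_zero
        have hq0' : (0 : ℝ) < q := Nat.cast_pos.2 (Nat.pos_of_ne_zero hq0)
        have hs0' : (0 : ℝ) < s := Nat.cast_pos.2 (Nat.pos_of_ne_zero hs0)
        have h1 : √2 ^ cardFactors (q ^ 2) ≤ (q : ℝ) := by
          rw [ArithmeticFunction.cardFactors_pow, pow_mul, Real.sq_sqrt zero_le_two]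
          exact_mod_cast two_pow_cardFactors_le hq0
        have h2 : √2 ^ cardFactors s ≤ (s.divisors.card : ℝ) := by
          have h3 : √2 ≤ 2 := Real.sqrt_le_iff.2 ⟨zero_le_two, by norm_num⟩
          refine (pow_le_pow_left₀ (Real.sqrt_nonneg 2) h3 _).trans ?_
          rw [← (ArithmeticFunction.cardDistinctFactors_eq_cardFactors_iff_squarefree hs0).2 hsq]
          exact_mod_cast two_pow_cardDistinctFactors_le_card_divisors hs0
        rw [ArithmeticFunction.cardFactors_mul (pow_ne_zero 2 hq0) hs0, pow_add, Nat.cast_mul,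
          mul_div_mul_comm, Nat.cast_pow]
        refine mul_le_mul ?_ (div_le_div_of_nonneg_right h2 hs0'.le) (by positivity) (by positivity)
        rw [div_le_div_iff₀ (by positivity) hq0', one_mul, sq (q : ℝ)]
        exact mul_le_mul_of_nonneg_right h1 hq0'.le
    _ = (∑ q ∈ Finset.Icc 1 N, 1 / (q : ℝ)) *
          ∑ s ∈ (Finset.Icc 1 N).filter Squarefree, (s.divisors.card : ℝ) / s := by
        rw [Finset.sum_mul_sum]
    _ ≤ (∑ q ∈ Finset.Icc 1 N, 1 / (q : ℝ)) * (∑ n ∈ Finset.Icc 1 N, 1 / (n : ℝ)) ^ 2 := by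
        refine mul_le_mul_of_nonneg_left ?_ (Finset.sum_nonneg fun _ _ => by positivity)
        refine le_trans ?_ (sum_card_divisors_div_le N)
        exact Finset.sum_le_sum_of_subset_of_nonneg (Finset.filter_subset _ _)
          fun _ _ _ => by positivity
    _ = (∑ n ∈ Finset.Icc 1 N, 1 / (n : ℝ)) ^ 3 := by ring

/-- The excess weight `√2 ^ Ω(n) / (log₂ n)⁵`, with the integer part of the binary logarithm. It
vanishes at `n = 0, 1`, where the denominator is `0`. -/
noncomputable def excessWeight (n : ℕ) : ℝ := √2 ^ cardFactors n / (Nat.log 2 n : ℝ) ^ 5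

lemma excessWeight_nonneg (n : ℕ) : 0 ≤ excessWeight n := by
  unfold excessWeight; positivity

/-- A dyadic block `2ᵏ ≤ n < 2ᵏ⁺¹` contributes at most `(k + 2)³ / k⁵`. -/
lemma summable_excessWeight_div : Summable fun n : ℕ => excessWeight n / n := by
  have hu : Summable fun k : ℕ => ((k : ℝ) + 2) ^ 3 / (k : ℝ) ^ 5 := by
    refine Summable.of_nonneg_of_le (fun _ => by positivity) (fun k => ?_)
      ((Real.summable_one_div_nat_pow.2 one_lt_two).mul_left 27)
    rcases Nat.eq_zero_or_pos k with rfl | hk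
    · simp
    have hk' : (1 : ℝ) ≤ k := by exact_mod_cast hk
    have h1 : ((k : ℝ) + 2) ^ 3 ≤ (3 * k) ^ 3 := by gcongr; linarith
    rw [mul_one_div, div_le_div_iff₀ (by positivity) (by positivity)]
    calc ((k : ℝ) + 2) ^ 3 * (k : ℝ) ^ 2 ≤ (3 * k) ^ 3 * (k : ℝ) ^ 2 := by gcongr
      _ = 27 * (k : ℝ) ^ 5 := by ring
  have hterm : ∀ n : ℕ, 0 ≤ excessWeight n / n := fun n =>
    div_nonneg (excessWeight_nonneg n) (Nat.cast_nonneg n)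
  have hblock : ∀ k : ℕ, ∑ n ∈ Finset.Ico (2 ^ k) (2 ^ (k + 1)), excessWeight n / n ≤
      ((k : ℝ) + 2) ^ 3 / (k : ℝ) ^ 5 := by
    intro k
    calc ∑ n ∈ Finset.Ico (2 ^ k) (2 ^ (k + 1)), excessWeight n / n
        = (∑ n ∈ Finset.Ico (2 ^ k) (2 ^ (k + 1)), √2 ^ cardFactors n / n) / (k : ℝ) ^ 5 := by
          rw [Finset.sum_div]
          refine Finset.sum_congr rfl fun n hn => ?_
          obtain ⟨h1, h2⟩ := Finset.mem_Ico.1 hn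
          rw [excessWeight, Nat.log_eq_of_pow_le_of_lt_pow h1 h2, div_right_comm]
      _ ≤ (∑ n ∈ Finset.Icc 1 (2 ^ (k + 1)), √2 ^ cardFactors n / n) / (k : ℝ) ^ 5 := by
          refine div_le_div_of_nonneg_right ?_ (by positivity)
          refine Finset.sum_le_sum_of_subset_of_nonneg (fun n hn => ?_) fun _ _ _ => by positivity
          obtain ⟨h1, h2⟩ := Finset.mem_Ico.1 hn
          exact Finset.mem_Icc.2 ⟨Nat.one_le_two_pow.trans h1, h2.le⟩
      _ ≤ ((k : ℝ) + 2) ^ 3 / (k : ℝ) ^ 5 := by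
          gcongr
          refine (sum_sqrt_two_pow_cardFactors_div_le _).trans ?_
          rw [← natCast_harmonic_eq]
          have h0 : (0 : ℝ) ≤ (harmonic (2 ^ (k + 1)) : ℚ) := by
            rw [natCast_harmonic_eq]; positivity
          have hlog : Real.log 2 ≤ 1 := by linarith [Real.log_two_lt_d9]
          have h3 := harmonic_le_one_add_log (2 ^ (k + 1))
          push_cast at h3
          rw [Real.log_pow] at h3
          push_cast at h3
          gcongr
          nlinarith [(Nat.cast_nonneg k : (0 : ℝ) ≤ k)]
  have hdyadic : ∀ m : ℕ, ∑ n ∈ Finset.range (2 ^ m), excessWeight n / n ≤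
      ∑ k ∈ Finset.range m, ((k : ℝ) + 2) ^ 3 / (k : ℝ) ^ 5 := by
    intro m
    induction m with
    | zero => simp
    | succ m ih =>
      rw [Finset.sum_range_succ, ← Finset.sum_range_add_sum_Ico _
        (Nat.pow_le_pow_right two_pos m.le_succ)]
      exact add_le_add ih (hblock m)
  refine summable_of_sum_range_le (c := ∑' k : ℕ, ((k : ℝ) + 2) ^ 3 / (k : ℝ) ^ 5) hterm
    fun m => ?_
  calc ∑ n ∈ Finset.range m, excessWeight n / n
      ≤ ∑ n ∈ Finset.range (2 ^ m), excessWeight n / n :=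
        Finset.sum_le_sum_of_subset_of_nonneg
          (Finset.range_mono Nat.lt_two_pow_self.le) fun _ _ _ => hterm _
    _ ≤ ∑ k ∈ Finset.range m, ((k : ℝ) + 2) ^ 3 / (k : ℝ) ^ 5 := hdyadic m
    _ ≤ ∑' k : ℕ, ((k : ℝ) + 2) ^ 3 / (k : ℝ) ^ 5 :=
        hu.sum_le_tsum _ fun _ _ => by positivity

/-- The inequality `x ≤ exp x` at `x = Ω(n) log √2 - 5 log log₂ n`. -/
lemma cardFactors_mul_log_sqrt_two_le (n : ℕ) :
    (cardFactors n : ℝ) * Real.log √2 ≤ 5 * Real.log (Nat.log 2 n) + excessWeight n := by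
  rcases Nat.lt_or_ge n 2 with hn | hn
  · interval_cases n <;> simp [excessWeight]
  have hk : (0 : ℝ) < Nat.log 2 n := by exact_mod_cast Nat.log_pos one_lt_two hn
  have h2 : (0 : ℝ) < √2 := Real.sqrt_pos.2 two_pos
  have h := Real.add_one_le_exp
    ((cardFactors n : ℝ) * Real.log √2 - 5 * Real.log (Nat.log 2 n))
  have h5 : Real.exp ((cardFactors n : ℝ) * Real.log √2 - 5 * Real.log (Nat.log 2 n)) =
      excessWeight n := by
    rw [Real.exp_sub, excessWeight, mul_comm, Real.exp_mul, Real.exp_log h2, Real.rpow_natCast,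
      mul_comm, Real.exp_mul, Real.exp_log hk]
    norm_cast
  rw [h5] at h
  linarith

lemma exists_eventually_cardFactors_le :
    ∃ C : ℝ, 0 ≤ C ∧ ∀ᶠ K : ℕ in atTop, ∀ n ∈ Finset.Icc 1 K,
      (cardFactors n : ℝ) ≤ C * (primeReciprocalSum K + excessWeight n) := by
  obtain ⟨C, hC⟩ := exists_log_natLog_le_primeReciprocalSum_add
  have hc : 0 < Real.log √2 := Real.log_pos (Real.lt_sqrt_of_sq_lt (by norm_num))
  -- `5 log log₂ n ≤ 5 (L K + C) ≤ 10 L K` as soon as `L K ≥ C`.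
  refine ⟨10 / Real.log √2, by positivity, ?_⟩
  filter_upwards [tendsto_primeReciprocalSum_atTop.eventually_ge_atTop C, eventually_ge_atTop 2]
    with K hLK hK n hn
  obtain ⟨hn1, hnK⟩ := Finset.mem_Icc.1 hn
  have h1 := cardFactors_mul_log_sqrt_two_le n
  have h2 : Real.log (Nat.log 2 n) ≤ Real.log (Nat.log 2 K) := by
    rcases Nat.eq_zero_or_pos (Nat.log 2 n) with h0 | h0
    · rw [h0, Nat.cast_zero, Real.log_zero]
      exact Real.log_natCast_nonneg _
    · exact Real.log_le_log (Nat.cast_pos.2 h0) (by exact_mod_cast Nat.log_mono_right hnK)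
  have h3 := hC K hK
  have h4 := excessWeight_nonneg n
  rw [div_mul_eq_mul_div, le_div_iff₀ hc]
  linarith

/-! ### Weighted ergodic averages -/

section Weighted

variable {X : Type*} [MeasurableSpace X] {μ : Measure X} {T : X → X}
  {𝕜 : Type*} [RCLike 𝕜] {f : X → 𝕜}

lemma integrable_norm_indicator_lt (hf : Integrable f μ) (M : ℕ) :
    Integrable (fun x => {z : 𝕜 | (M : ℝ) < ‖z‖}.indicator (fun z => ‖z‖) (f x)) μ := by
  have hm : Measurable ({z : 𝕜 | (M : ℝ) < ‖z‖}.indicator fun z => ‖z‖) :=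
    measurable_norm.indicator (measurableSet_lt measurable_const measurable_norm)
  refine hf.norm.mono (hm.comp_aemeasurable hf.1.aemeasurable).aestronglyMeasurable
    (Eventually.of_forall fun x => ?_)
  exact norm_indicator_le_norm_self _ _

lemma tendsto_integral_norm_indicator_lt (hf : Integrable f μ) :
    Tendsto (fun M : ℕ => ∫ x, {z : 𝕜 | (M : ℝ) < ‖z‖}.indicator (fun z => ‖z‖) (f x) ∂μ) atTop
      (𝓝 0) := by
  rw [← integral_zero X ℝ (μ := μ)]
  refine tendsto_integral_of_dominated_convergence (fun x => ‖f x‖) (fun M => ?_) hf.norm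
    (fun M => Eventually.of_forall fun x => ?_) (Eventually.of_forall fun x => ?_)
  · exact (integrable_norm_indicator_lt hf M).1
  · exact (norm_indicator_le_norm_self _ _).trans_eq (norm_norm _)
  · refine tendsto_const_nhds.congr' ?_
    obtain ⟨N, hN⟩ := exists_nat_ge ‖f x‖
    filter_upwards [eventually_ge_atTop N] with M hM
    have hNM : (N : ℝ) ≤ M := Nat.cast_le.2 hM
    rw [Set.indicator_of_notMem]
    exact not_lt.2 (hN.trans hNM)

/-- The integral of the series is `∑ c n · ‖f‖₁` by invariance of the measure. -/
lemma ae_summable_mul_norm_iterate (hT : MeasurePreserving T μ μ) (hf : Integrable f μ)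
    {c : ℕ → ℝ} (hc0 : ∀ n, 0 ≤ c n) (hc : Summable c) :
    ∀ᵐ x ∂μ, Summable fun n : ℕ => c n * ‖f (T^[n] x)‖ := by
  have hm : ∀ n, AEMeasurable (fun x => ENNReal.ofReal (c n) * ‖f (T^[n] x)‖ₑ) μ := fun n =>
    ((hT.iterate n).integrable_comp_of_integrable hf).1.enorm.const_mul _
  have hint : ∫⁻ x, ∑' n, ENNReal.ofReal (c n) * ‖f (T^[n] x)‖ₑ ∂μ ≠ ⊤ := by
    rw [lintegral_tsum hm]
    have h : ∀ n, ∫⁻ x, ENNReal.ofReal (c n) * ‖f (T^[n] x)‖ₑ ∂μ =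
        ENNReal.ofReal (c n) * ∫⁻ x, ‖f x‖ₑ ∂μ := by
      intro n
      rw [lintegral_const_mul' _ _ ENNReal.ofReal_ne_top]
      congr 1
      have h1 := lintegral_map' (μ := μ) (g := T^[n]) (f := fun x => ‖f x‖ₑ)
        (by rw [(hT.iterate n).map_eq]; exact hf.1.enorm) (hT.iterate n).measurable.aemeasurable
      rw [(hT.iterate n).map_eq] at h1
      exact h1.symm
    simp_rw [h]
    rw [ENNReal.tsum_mul_right, ← ENNReal.ofReal_tsum_of_nonneg hc0 hc]
    exact ENNReal.mul_ne_top ENNReal.ofReal_ne_top hf.2.ne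
  filter_upwards [ae_lt_top' (AEMeasurable.tsum hm) hint] with x hx
  have h := ENNReal.summable_toReal hx.ne
  refine h.congr fun n => ?_
  rw [ENNReal.toReal_mul, ENNReal.toReal_ofReal (hc0 n), toReal_enorm]

end Weighted

theorem mainTheorem1 {X : Type*} [MeasurableSpace X]
    (μ : MeasureTheory.Measure X) [MeasureTheory.IsProbabilityMeasure μ]
    (T : X → X) (hT : Ergodic T μ)
    {𝕜 : Type*} [RCLike 𝕜]
    (g : ArithmeticFunction ℕ)
    (hg : g = ArithmeticFunction.cardDistinctFactors ∨ g = ArithmeticFunction.cardFactors)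
    (f : X → 𝕜) (hf : MeasureTheory.Integrable f μ) :
    ∀ᵐ x ∂μ, Filter.Tendsto (fun K : ℕ => weightedErgodicAverage (fun n => g n) T f K x)
      Filter.atTop (nhds (∫ y, f y ∂μ)) := by
  have hlo : ∀ n, cardDistinctFactors n ≤ g n := by
    rcases hg with rfl | rfl
    exacts [fun n => le_rfl, cardDistinctFactors_le_cardFactors]
  have hup : ∀ n, g n ≤ cardFactors n := by
    rcases hg with rfl | rfl
    exacts [cardDistinctFactors_le_cardFactors, fun n => le_rfl]
  obtain ⟨C, hC0, hC⟩ := exists_eventually_cardFactors_le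
  have hgb : ∀ᶠ K : ℕ in atTop, ∀ n ∈ Finset.Icc 1 K,
      (g n : ℝ) ≤ C * (primeReciprocalSum K + excessWeight n) := by
    filter_upwards [hC] with K hK n hn
    exact (Nat.cast_le.2 (hup n)).trans (hK n hn)
  have htail : ∀ᵐ x ∂μ, ∀ M : ℕ, Tendsto (fun K : ℕ => (1 / (K : ℝ)) *
      ∑ n ∈ Finset.Icc 1 K, {z : 𝕜 | (M : ℝ) < ‖z‖}.indicator (fun z => ‖z‖) (f (T^[n] x)))
      atTop (𝓝 (∫ y, {z : 𝕜 | (M : ℝ) < ‖z‖}.indicator (fun z => ‖z‖) (f y) ∂μ)) :=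
    ae_all_iff.2 fun M => ae_tendsto_average_iterate hT (integrable_norm_indicator_lt hf M)
  have hexcess := ae_summable_mul_norm_iterate hT.toMeasurePreserving hf
    (fun n => div_nonneg (excessWeight_nonneg n) (Nat.cast_nonneg n)) summable_excessWeight_div
  filter_upwards [ae_tendsto_average_iterate hT hf, htail, hexcess] with x hx hxtail hxexcess
  exact tendsto_weighted_average hC0 tendsto_primeReciprocalSum_atTop
    (tendsto_sum_abs_sub_primeReciprocalSum_div hlo hup) excessWeight_nonneg hgb hx
    (tendsto_integral_norm_indicator_lt hf) hxtail hxexcess
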